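/- Let $k\ge 3$ and $n\ge 3k(k-1)+2$, let $\mathcal A$ be a set of $n$ elements with a strict ranking $\succ$ (the ground truth), and let $G=(U,V,E)$ be a $k$-regular bipartite graph with $|U|=|V|=n$ (an $(n,k)$-bundle graph). Place the elements on the nodes of $U$ by a uniformly random bijection $\sigma:U\to\mathcal A$; each node $v\in V$ then defines the bundle $\{\sigma(u):(u,v)\in E\}$ of $k$ elements, and each bundle is ranked consistently with $\succ$. An element receives $k$ points from each bundle in which it is ranked first, $k-1$ points from each bundle in which it is ranked second, and so on; its Borda score is the total number of points that it receives. Borda outputs a ranking of $\mathcal A$ that sorts the elements in decreasing order of their Borda scores. Then, however ties between equal scores are resolved (possibly depending on $\sigma$), the expected fraction of the $\binom n2$ pairwise relations of $\succ$ that agree with the output of Borda is at least $$1-\frac{48\sqrt{2\pi}}{\sqrt k}=1-O\big(1/\sqrt k\big),$$ and, if $G$ has girth at least $6$, it is at least $$1-\frac{16\sqrt{3\pi}}{k}=1-O(1/k).$$ -/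

import Mathlib

open scoped BigOperators

/-- A (strict, complete) ranking of the elements of `X`: `r.above x y` means that `x` is ranked
above (better than) `y`. -/
structure Ranking (X : Type*) where
  above : X → X → Prop
  irrefl : ∀ x, ¬ above x x
  trans : ∀ x y z, above x y → above y z → above x z
  total : ∀ x y, x ≠ y → above x y ∨ above y x

namespace Ranking

open Classical in
/-- The position of an element in a ranking; the element ranked first has position `1`. -/
noncomputable def position {X : Type*} [Fintype X] (r : Ranking X) (x : X) : ℕ :=
  (Finset.univ.filter fun y => r.above y x).card + 1

end Ranking

/-- `G` is an `(n, k)`-bundle graph with sides `U` (nodes for the elements) and `V` (nodes for the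
bundles): both sides have `n` nodes, all edges run between `U` and `V`, and `G` is `k`-regular. -/
structure IsBundleGraph {U V : Type*} [Fintype U] [Fintype V]
    (G : SimpleGraph (U ⊕ V)) [DecidableRel G.Adj] (n k : ℕ) : Prop where
  card_left : Fintype.card U = n
  card_right : Fintype.card V = n
  bipartite : G ≤ completeBipartiteGraph U V
  regular : G.IsRegularOfDegree k

section Borda

variable {U V A : Type*} [Fintype V] [Fintype A]

open Classical in
/-- The bundle of elements associated with the node `v`, when the elements of `A` are placed on
the nodes of `U` by the bijection `σ`. -/
noncomputable def bundle (G : SimpleGraph (U ⊕ V)) (σ : U ≃ A) (v : V) : Finset A :=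
  Finset.univ.filter fun x => G.Adj (Sum.inl (σ.symm x)) (Sum.inr v)

/-- A profile: one partial ranking for each bundle, ranking exactly the elements of the bundle. -/
def Profile (G : SimpleGraph (U ⊕ V)) (σ : U ≃ A) :=
  ∀ v : V, Ranking {x : A // x ∈ bundle G σ v}

/-- All partial rankings of the profile are consistent with the ground truth `gt`. -/
def Profile.IsConsistent {G : SimpleGraph (U ⊕ V)} {σ : U ≃ A} (P : Profile G σ)
    (gt : Ranking A) : Prop :=
  ∀ (v : V) (x y : {x : A // x ∈ bundle G σ v}), (P v).above x y ↔ gt.above x.1 y.1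

open Classical in
/-- The Borda score of `x`: from every partial ranking in which it appears, `x` gets `k` points if
it is ranked first, `k - 1` points if it is ranked second, and so on.  (Positions are at most `k`
when bundles have size `k`, so that the subtraction is exact.) -/
noncomputable def bordaScore (k : ℕ) {G : SimpleGraph (U ⊕ V)} {σ : U ≃ A} (P : Profile G σ)
    (x : A) : ℕ :=
  ∑ v : V, if h : x ∈ bundle G σ v then k + 1 - (P v).position ⟨x, h⟩ else 0

/-- `out` is an outcome of Borda on the profile `P`: a complete ranking that sorts the elements in
decreasing order of their Borda scores, with ties resolved in an arbitrary way. -/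
def IsBordaOutcome (k : ℕ) {G : SimpleGraph (U ⊕ V)} {σ : U ≃ A} (P : Profile G σ)
    (out : Ranking A) : Prop :=
  ∀ x y : A, bordaScore k P y < bordaScore k P x → out.above x y

open Classical in
/-- The fraction of the pairwise relations of the ground truth `gt` that `out` agrees with. -/
noncomputable def recoveredFraction (gt out : Ranking A) : ℝ :=
  ((Finset.univ.filter fun p : A × A => gt.above p.1 p.2 ∧ out.above p.1 p.2).card : ℝ) /
    ((Fintype.card A).choose 2 : ℝ)

end Borda

/-!
The score of an element `x` is `k * k` minus the number `L x` of points that it loses, and `L x` is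
the sum, over the elements `z` better than `x`, of the number of bundles that contain both `x` and
`z` (`bordaScore_eq`). For fixed `x`, these numbers of shared bundles, as `z` runs over all elements
other than `x`, are exchangeable random variables, because a uniformly random bijection is invariant
under swapping two elements, and their total is `k * (k - 1)`, whatever the bijection. Exchangeable
variables with constant total are negatively correlated, so `L x`, a partial sum, has variance at
most `M * (k * (k - 1))` if no two elements share more than `M` bundles
(`expect_partial_sum_sq_le`).

The mean of `L x` is proportional to the number of elements above `x`. If `x` is `d` positions above
`y`, then `L y - L x` has mean `k * (k - 1) * d / (n - 1)`, and Borda can only place `y` above `x` if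
this difference is nonpositive. By Chebyshev's inequality (`expect_misordered_mul_sq_le`) this has
probability at most `T ^ 2 / d ^ 2`, where `T = 2 * (n - 1) * √(M / (k * (k - 1)))`. The sum of
`min 1 (T ^ 2 / d ^ 2)` over `d ≥ 1` is at most `4 * T` (`sum_four_mul_sq_div_le`), so the expected
number of wrongly ordered pairs is at most `4 * T * n`, a fraction `16 * √(M / (k * (k - 1)))` of all
pairs (`one_sub_le_expect_recoveredFraction`).

In general `M = k`, which gives an error of order `1 / √k`; if the girth is at least `6`, two
elements share at most one bundle, so `M = 1` (`commonBundles_le_one`) and the error is of order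
`1 / k`. The second moment method thus suffices, and beats the constants of the theorem.
-/

/-! ### Partial sums of exchangeable variables with constant total -/

/-- If the sum of the variables `X i`, `i ∈ s`, is constant and all covariances are equal, then
they are negative: conditioning on `X i`, the remaining variables have to compensate for it. -/
theorem expect_mul_nonpos_of_sum_eq_zero {Ω ι : Type*} [Fintype Ω] [DecidableEq ι]
    {s : Finset ι} {Y : ι → Ω → ℝ} (hsum : ∀ ω, ∑ i ∈ s, Y i ω = 0)
    (hexch : ∀ i ∈ s, ∀ j ∈ s, ∀ l ∈ s, i ≠ j → i ≠ l →
      𝔼 ω, Y i ω * Y j ω = 𝔼 ω, Y i ω * Y l ω)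
    {i j : ι} (hi : i ∈ s) (hj : j ∈ s) (hij : i ≠ j) : 𝔼 ω, Y i ω * Y j ω ≤ 0 := by
  have hj' : j ∈ s.erase i := Finset.mem_erase.2 ⟨hij.symm, hj⟩
  have htot : ∑ l ∈ s.erase i, 𝔼 ω, Y i ω * Y l ω = - 𝔼 ω, Y i ω * Y i ω := by
    have h0 : ∑ l ∈ s, 𝔼 ω, Y i ω * Y l ω = 0 := by
      rw [← Finset.expect_sum_comm]
      simp [← Finset.mul_sum, hsum]
    rw [← Finset.add_sum_erase s _ hi] at h0
    linarith
  have hconst : ∑ l ∈ s.erase i, 𝔼 ω, Y i ω * Y l ω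
      = (s.erase i).card * 𝔼 ω, Y i ω * Y j ω := by
    rw [Finset.sum_congr rfl fun l hl => hexch i hi l (Finset.mem_of_mem_erase hl) j hj
      (Finset.ne_of_mem_erase hl).symm hij]
    simp
  have hsq : 0 ≤ 𝔼 ω, Y i ω * Y i ω := Finset.expect_nonneg fun ω _ => mul_self_nonneg _
  have hcard : (0 : ℝ) < (s.erase i).card := by exact_mod_cast Finset.card_pos.2 ⟨j, hj'⟩
  by_contra! hpos
  nlinarith [mul_pos hcard hpos]

/-- The variance of a partial sum of exchangeable variables with values in `[0, M]` whose total
sum is the constant `K` is at most `M * K`. -/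
theorem expect_partial_sum_sq_le {Ω ι : Type*} [Fintype Ω] [Nonempty Ω] [DecidableEq ι]
    {s t : Finset ι} (hts : t ⊆ s) {X : ι → Ω → ℝ} {K M : ℝ}
    (hsum : ∀ ω, ∑ i ∈ s, X i ω = K)
    (hexch₁ : ∀ i ∈ s, ∀ j ∈ s, 𝔼 ω, X i ω = 𝔼 ω, X j ω)
    (hexch₂ : ∀ i ∈ s, ∀ j ∈ s, ∀ l ∈ s, i ≠ j → i ≠ l →
      𝔼 ω, X i ω * X j ω = 𝔼 ω, X i ω * X l ω)
    (h0 : ∀ i ∈ s, ∀ ω, 0 ≤ X i ω) (hM : ∀ i ∈ s, ∀ ω, X i ω ≤ M) :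
    𝔼 ω, (∑ i ∈ t, X i ω - t.card * (K / s.card)) ^ 2 ≤ M * K := by
  rcases s.eq_empty_or_nonempty with rfl | ⟨i₀, hi₀⟩
  · obtain rfl : t = ∅ := Finset.subset_empty.1 hts
    have hK : K = 0 := by simpa using (hsum (Classical.arbitrary Ω)).symm
    simp [hK]
  have hs : (0 : ℝ) < s.card := by exact_mod_cast Finset.card_pos.2 ⟨i₀, hi₀⟩
  set μ : ℝ := K / s.card with hμ
  have hμs : s.card * μ = K := by rw [hμ]; field_simp
  have hmean : ∀ i ∈ s, 𝔼 ω, X i ω = μ := by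
    intro i hi
    have h1 : ∑ j ∈ s, 𝔼 ω, X j ω = K := by
      rw [← Finset.expect_sum_comm]
      simp [hsum]
    rw [Finset.sum_congr rfl fun j hj => hexch₁ j hj i hi] at h1
    rw [hμ, eq_div_iff hs.ne', ← h1]
    simp [mul_comm]
  have hcov : ∀ i ∈ s, ∀ j ∈ s, 𝔼 ω, (X i ω - μ) * (X j ω - μ)
      = 𝔼 ω, X i ω * X j ω - μ ^ 2 := by
    intro i hi j hj
    have : ∀ ω, (X i ω - μ) * (X j ω - μ)
        = X i ω * X j ω - μ * X i ω - μ * X j ω + μ ^ 2 := fun ω => by ring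
    simp only [this, Finset.expect_add_distrib, Finset.expect_sub_distrib, ← Finset.mul_expect,
      hmean i hi, hmean j hj, Fintype.expect_const]
    ring
  have hvar : ∀ i ∈ s, 𝔼 ω, (X i ω - μ) * (X i ω - μ) ≤ M * μ := by
    intro i hi
    rw [hcov i hi i hi]
    have : 𝔼 ω, X i ω * X i ω ≤ 𝔼 ω, M * X i ω :=
      Finset.expect_le_expect fun ω _ => mul_le_mul_of_nonneg_right (hM i hi ω) (h0 i hi ω)
    rw [← Finset.mul_expect, hmean i hi] at this
    nlinarith [sq_nonneg μ]
  have hneg : ∀ i ∈ s, ∀ j ∈ s, i ≠ j → 𝔼 ω, (X i ω - μ) * (X j ω - μ) ≤ 0 := by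
    intro i hi j hj hij
    refine expect_mul_nonpos_of_sum_eq_zero (Y := fun i ω => X i ω - μ) (fun ω => ?_) ?_ hi hj hij
    · simp [hsum, hμs]
    · intro i hi j hj l hl hij hil
      rw [hcov i hi j hj, hcov i hi l hl, hexch₂ i hi j hj l hl hij hil]
  have hMμ : 0 ≤ M * μ :=
    le_trans (Finset.expect_nonneg fun ω _ => mul_self_nonneg _) (hvar i₀ hi₀)
  calc 𝔼 ω, (∑ i ∈ t, X i ω - t.card * μ) ^ 2
      = 𝔼 ω, ∑ i ∈ t, ∑ j ∈ t, (X i ω - μ) * (X j ω - μ) := by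
        refine Finset.expect_congr rfl fun ω _ => ?_
        rw [← Finset.sum_mul_sum]
        simp [sq]
    _ = ∑ i ∈ t, ∑ j ∈ t, 𝔼 ω, (X i ω - μ) * (X j ω - μ) := by
        rw [Finset.expect_sum_comm]
        exact Finset.sum_congr rfl fun i _ => Finset.expect_sum_comm _ _ _
    _ ≤ ∑ i ∈ t, M * μ := by
        refine Finset.sum_le_sum fun i hi => ?_
        rw [← Finset.add_sum_erase t _ hi]
        have h1 := hvar i (hts hi)
        have h2 : ∑ j ∈ t.erase i, 𝔼 ω, (X i ω - μ) * (X j ω - μ) ≤ 0 :=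
          Finset.sum_nonpos fun j hj => hneg i (hts hi) j (hts (Finset.mem_of_mem_erase hj))
            (Finset.ne_of_mem_erase hj).symm
        linarith
    _ ≤ ∑ i ∈ s, M * μ := Finset.sum_le_sum_of_subset_of_nonneg hts fun _ _ _ => hMμ
    _ = M * K := by rw [Finset.sum_const, nsmul_eq_mul, ← hμs]; ring

/-! ### Summing the error probabilities -/

/-- The bound `min 1 (T² / d²) ≤ 4 T² / (T + d)²` on a probability, summed over distinct positive
integers `d`, telescopes. -/
theorem sum_four_mul_sq_div_le {T : ℝ} (hT : 0 < T) (N : ℕ) :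
    ∑ d ∈ Finset.range N, 4 * T ^ 2 / (T + (d + 1 : ℕ)) ^ 2 ≤ 4 * T := by
  have key : ∑ d ∈ Finset.range N, 4 * T ^ 2 / (T + (d + 1 : ℕ)) ^ 2
      ≤ 4 * T ^ 2 * (1 / T - 1 / (T + N)) := by
    induction N with
    | zero => simp
    | succ N ih =>
      rw [Finset.sum_range_succ]
      have hN : (0 : ℝ) ≤ N := N.cast_nonneg
      have : 4 * T ^ 2 / (T + (N + 1 : ℕ)) ^ 2
          ≤ 4 * T ^ 2 * (1 / (T + N) - 1 / (T + (N + 1 : ℕ))) := by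
        push_cast
        rw [div_sub_div _ _ (by positivity) (by positivity), ← mul_div_assoc]
        refine (div_le_div_iff₀ (by positivity) (by positivity)).2 ?_
        have : 0 ≤ T ^ 2 * (T + (N + 1)) := by positivity
        nlinarith
      linarith
  have hpos : 0 ≤ 4 * T ^ 2 * (1 / (T + N)) := by positivity
  have hfour : 4 * T ^ 2 * (1 / T) = 4 * T := by field_simp
  linarith

theorem le_four_mul_sq_div {p T d : ℝ} (hT : 0 < T) (hd : 0 < d) (hp0 : 0 ≤ p) (hp1 : p ≤ 1)
    (hp : p * d ^ 2 ≤ T ^ 2) : p ≤ 4 * T ^ 2 / (T + d) ^ 2 := by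
  rw [le_div_iff₀ (by positivity)]
  rcases le_total d T with h | h
  · nlinarith [mul_le_mul hp1 (by nlinarith : (T + d) ^ 2 ≤ 4 * T ^ 2) (by positivity) zero_le_one]
  · nlinarith [mul_le_mul_of_nonneg_left (by nlinarith : (T + d) ^ 2 ≤ 4 * d ^ 2) hp0]

/-! ### Positions in a ranking -/

namespace Ranking

variable {X : Type*} [Fintype X] (r : Ranking X)

open Classical in
/-- The elements ranked above `x`. -/
noncomputable def upper (x : X) : Finset X := Finset.univ.filter fun y => r.above y x

theorem mem_upper {x y : X} : y ∈ r.upper x ↔ r.above y x := by simp [upper]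

theorem position_eq (x : X) : r.position x = (r.upper x).card + 1 := rfl

theorem position_lt {x y : X} (h : r.above x y) : r.position x < r.position y := by
  rw [position_eq, position_eq, add_lt_add_iff_right]
  refine Finset.card_lt_card (Finset.ssubset_iff_subset_ne.2 ⟨fun z hz => ?_, fun he => ?_⟩)
  · exact r.mem_upper.2 (r.trans z x y (r.mem_upper.1 hz) h)
  · exact r.irrefl x (r.mem_upper.1 (he ▸ r.mem_upper.2 h))

theorem position_injective : Function.Injective r.position := by
  intro x y h
  by_contra hne
  rcases r.total x y hne with h' | h'
  · exact (r.position_lt h').ne h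
  · exact (r.position_lt h').ne h.symm

theorem position_le_card (x : X) : r.position x ≤ Fintype.card X := by
  rw [position_eq]
  exact Finset.card_lt_univ_of_notMem fun h => r.irrefl x (r.mem_upper.1 h)

open Classical in
theorem card_filter_above :
    (Finset.univ.filter fun p : X × X => r.above p.1 p.2).card = (Fintype.card X).choose 2 := by
  have hswap : (Finset.univ.filter fun p : X × X => r.above p.2 p.1).card
      = (Finset.univ.filter fun p : X × X => r.above p.1 p.2).card := by
    refine Finset.card_bij (fun p _ => p.swap) ?_ ?_ ?_
    · simp
    · intro p _ q _ h
      exact Prod.swap_injective h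
    · intro p hp
      exact ⟨p.swap, by simpa using hp, by simp⟩
  have hunion : (Finset.univ : Finset X).offDiag
      = (Finset.univ.filter fun p : X × X => r.above p.1 p.2)
        ∪ (Finset.univ.filter fun p : X × X => r.above p.2 p.1) := by
    ext ⟨x, y⟩
    simp only [Finset.mem_offDiag, Finset.mem_univ, true_and, Finset.mem_union,
      Finset.mem_filter]
    refine ⟨r.total x y, ?_⟩
    rintro (h | h) rfl <;> exact r.irrefl _ h
  have hdisj : Disjoint (Finset.univ.filter fun p : X × X => r.above p.1 p.2)
      (Finset.univ.filter fun p : X × X => r.above p.2 p.1) := by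
    refine Finset.disjoint_filter.2 fun p _ h h' => r.irrefl _ (r.trans _ _ _ h h')
  have hcard := congrArg Finset.card hunion
  rw [Finset.card_union_of_disjoint hdisj, hswap, Finset.offDiag_card, Finset.card_univ] at hcard
  rw [Nat.choose_two_right, Nat.mul_sub, mul_one]
  omega

/-- Since distinct elements have distinct positions, a sum over the elements below `x` of a
function of the difference in position is at most a sum over all positive integers. -/
theorem sum_above_le [DecidableRel r.above] (x : X) (f : ℕ → ℝ) (hf : ∀ d, 0 ≤ f d) :
    ∑ y ∈ Finset.univ.filter (fun y => r.above x y), f (r.position y - r.position x)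
      ≤ ∑ d ∈ Finset.range (Fintype.card X), f (d + 1) := by
  have hinj : Set.InjOn (fun y => r.position y - r.position x - 1)
      (Finset.univ.filter fun y => r.above x y : Finset X) := by
    intro y hy z hz h
    simp only [Finset.coe_filter, Finset.mem_univ, true_and, Set.mem_ofPred_eq] at hy hz h
    have h1 := r.position_lt hy
    have h2 := r.position_lt hz
    exact r.position_injective (by omega)
  have heq : ∑ y ∈ Finset.univ.filter (fun y => r.above x y), f (r.position y - r.position x)
      = ∑ y ∈ Finset.univ.filter (fun y => r.above x y),
          f (r.position y - r.position x - 1 + 1) := by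
    refine Finset.sum_congr rfl fun y hy => ?_
    have := r.position_lt (Finset.mem_filter.1 hy).2
    congr 1
    omega
  rw [heq, ← Finset.sum_image (f := fun d => f (d + 1)) hinj]
  refine Finset.sum_le_sum_of_subset_of_nonneg (fun d hd => ?_) fun _ _ _ => hf _
  obtain ⟨y, hy, rfl⟩ := Finset.mem_image.1 hd
  have h1 := r.position_lt (Finset.mem_filter.1 hy).2
  have h2 := r.position_le_card y
  have h3 : 1 ≤ r.position x := by rw [position_eq]; omega
  exact Finset.mem_range.2 (by omega)

end Ranking

/-! ### Common neighbours in a bundle graph -/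

/-- The number of bundles that contain both of the elements placed on `u` and `t`. -/
def commonBundles {U V : Type*} [Fintype V] (G : SimpleGraph (U ⊕ V)) [DecidableRel G.Adj]
    (u t : U) : ℕ :=
  (Finset.univ.filter fun v : V => G.Adj (Sum.inl u) (Sum.inr v) ∧
    G.Adj (Sum.inl t) (Sum.inr v)).card

theorem commonBundles_eq_sum {U V : Type*} [Fintype V] (G : SimpleGraph (U ⊕ V))
    [DecidableRel G.Adj] (u t : U) :
    commonBundles G u t = ∑ v : V, (if G.Adj (Sum.inl u) (Sum.inr v) then 1 else 0) *
      (if G.Adj (Sum.inl t) (Sum.inr v) then 1 else 0) := by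
  rw [commonBundles, Finset.card_filter]
  refine Finset.sum_congr rfl fun v _ => ?_
  rw [ite_and]
  split_ifs <;> rfl

namespace IsBundleGraph

theorem not_adj_inl {U V : Type*} [Fintype U] [Fintype V] {G : SimpleGraph (U ⊕ V)}
    [DecidableRel G.Adj] {n k : ℕ} (hG : IsBundleGraph G n k) (u t : U) :
    ¬ G.Adj (Sum.inl u) (Sum.inl t) := fun h => by simpa using hG.bipartite h

theorem not_adj_inr {U V : Type*} [Fintype U] [Fintype V] {G : SimpleGraph (U ⊕ V)}
    [DecidableRel G.Adj] {n k : ℕ} (hG : IsBundleGraph G n k) (v w : V) :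
    ¬ G.Adj (Sum.inr v) (Sum.inr w) := fun h => by simpa using hG.bipartite h

theorem sum_adj_left {U V : Type*} [Fintype U] [Fintype V] {G : SimpleGraph (U ⊕ V)}
    [DecidableRel G.Adj] {n k : ℕ} (hG : IsBundleGraph G n k) (u : U) :
    (∑ v : V, if G.Adj (Sum.inl u) (Sum.inr v) then 1 else 0) = k := by
  have h := hG.regular (Sum.inl u)
  rw [← SimpleGraph.card_neighborFinset_eq_degree, SimpleGraph.neighborFinset_eq_filter,
    Finset.card_filter, Fintype.sum_sum_type] at h
  simpa only [hG.not_adj_inl, if_false, Finset.sum_const_zero, zero_add] using h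

theorem sum_adj_right {U V : Type*} [Fintype U] [Fintype V] {G : SimpleGraph (U ⊕ V)}
    [DecidableRel G.Adj] {n k : ℕ} (hG : IsBundleGraph G n k) (v : V) :
    (∑ u : U, if G.Adj (Sum.inl u) (Sum.inr v) then 1 else 0) = k := by
  have h := hG.regular (Sum.inr v)
  rw [← SimpleGraph.card_neighborFinset_eq_degree, SimpleGraph.neighborFinset_eq_filter,
    Finset.card_filter, Fintype.sum_sum_type] at h
  simpa only [hG.not_adj_inr, if_false, Finset.sum_const_zero, add_zero, G.adj_comm (Sum.inr v)]
    using h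

theorem commonBundles_le {U V : Type*} [Fintype U] [Fintype V] {G : SimpleGraph (U ⊕ V)}
    [DecidableRel G.Adj] {n k : ℕ} (hG : IsBundleGraph G n k) (u t : U) :
    commonBundles G u t ≤ k := by
  rw [commonBundles, ← hG.sum_adj_left u, ← Finset.card_filter]
  exact Finset.card_le_card (Finset.monotone_filter_right _ fun v _ h => h.1)

/-- The other elements in the bundles of an element number `k * (k - 1)`, with multiplicity. -/
theorem sum_commonBundles {U V : Type*} [Fintype U] [DecidableEq U] [Fintype V]
    {G : SimpleGraph (U ⊕ V)} [DecidableRel G.Adj] {n k : ℕ} (hG : IsBundleGraph G n k) (u : U) :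
    ∑ t ∈ Finset.univ.erase u, (commonBundles G u t : ℝ) = k * (k - 1) := by
  have hall : ∑ t, commonBundles G u t = k * k := by
    simp only [commonBundles_eq_sum]
    rw [Finset.sum_comm]
    simp only [← Finset.mul_sum, hG.sum_adj_right, ← Finset.sum_mul, hG.sum_adj_left]
  have hself : commonBundles G u u = k := by
    simp only [commonBundles, and_self]
    rw [Finset.card_filter, hG.sum_adj_left]
  rw [← Finset.add_sum_erase _ _ (Finset.mem_univ u), hself] at hall
  have hall' : (k : ℝ) + ∑ t ∈ Finset.univ.erase u, (commonBundles G u t : ℝ) = k * k := by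
    exact_mod_cast hall
  linarith

end IsBundleGraph

/-- Two nodes with two common neighbours lie on a cycle of length `4`. -/
theorem commonBundles_le_one {U V : Type*} [Fintype V] {G : SimpleGraph (U ⊕ V)}
    [DecidableRel G.Adj] (hgirth : 6 ≤ G.egirth) {u t : U} (hut : u ≠ t) :
    commonBundles G u t ≤ 1 := by
  by_contra! h
  obtain ⟨v, hv, w, hw, hvw⟩ := Finset.one_lt_card.1 h
  obtain ⟨huv, htv⟩ := (Finset.mem_filter.1 hv).2
  obtain ⟨huw, htw⟩ := (Finset.mem_filter.1 hw).2
  let c : G.Walk (Sum.inl u) (Sum.inl u) :=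
    .cons huv (.cons htv.symm (.cons htw (.cons huw.symm .nil)))
  have hc : c.IsCycle := by
    simp [c, SimpleGraph.Walk.isCycle_def, SimpleGraph.Walk.isTrail_def, hut, hut.symm, hvw]
  have := hgirth.trans (SimpleGraph.le_egirth.1 le_rfl _ c hc)
  simp only [c, SimpleGraph.Walk.length_cons, SimpleGraph.Walk.length_nil] at this
  norm_num at this

/-! ### Borda scores -/

open Classical in
theorem Profile.IsConsistent.position_eq {U V A : Type*} [Fintype A]
    {G : SimpleGraph (U ⊕ V)} {σ : U ≃ A} {P : Profile G σ}
    {gt : Ranking A} (hP : P.IsConsistent gt) (v : V) (x : {x : A // x ∈ bundle G σ v}) :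
    (P v).position x = ((bundle G σ v).filter fun z => gt.above z x).card + 1 := by
  rw [Ranking.position, add_left_inj]
  refine Finset.card_bij (fun z _ => z.1) ?_ ?_ ?_
  · intro z hz
    exact Finset.mem_filter.2 ⟨z.2, (hP v z x).1 (Finset.mem_filter.1 hz).2⟩
  · intro z _ w _ h
    exact Subtype.ext h
  · intro z hz
    obtain ⟨hz, hzx⟩ := Finset.mem_filter.1 hz
    exact ⟨⟨z, hz⟩, Finset.mem_filter.2 ⟨Finset.mem_univ _, (hP v ⟨z, hz⟩ x).2 hzx⟩, rfl⟩

section Score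

variable {U V A : Type*} [Fintype U] [Fintype V] [Fintype A]

open Classical in
theorem card_bundle {G : SimpleGraph (U ⊕ V)} [DecidableRel G.Adj] {n k : ℕ}
    (hG : IsBundleGraph G n k) (σ : U ≃ A) (v : V) : (bundle G σ v).card = k := by
  rw [bundle, Finset.card_filter, ← hG.sum_adj_right v, ← Equiv.sum_comp σ.symm]
  refine Finset.sum_congr rfl fun x _ => ?_
  congr

open Classical in
/-- An element loses one point from the maximal score `k * k` for each better element in each of
its bundles. -/
theorem bordaScore_eq {G : SimpleGraph (U ⊕ V)} [DecidableRel G.Adj] {n k : ℕ}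
    (hG : IsBundleGraph G n k) {σ : U ≃ A} {P : Profile G σ} {gt : Ranking A}
    (hP : P.IsConsistent gt) (x : A) :
    (bordaScore k P x : ℝ)
      = k * k - ∑ z ∈ gt.upper x, (commonBundles G (σ.symm x) (σ.symm z) : ℝ) := by
  have hterm : ∀ v : V,
      (((if h : x ∈ bundle G σ v then k + 1 - (P v).position ⟨x, h⟩ else 0 : ℕ)) : ℝ)
        = (k : ℝ) * (if G.Adj (Sum.inl (σ.symm x)) (Sum.inr v) then 1 else 0)
          - ∑ z ∈ gt.upper x, (if G.Adj (Sum.inl (σ.symm x)) (Sum.inr v) then 1 else 0) *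
            (if G.Adj (Sum.inl (σ.symm z)) (Sum.inr v) then 1 else 0) := by
    intro v
    by_cases h : x ∈ bundle G σ v
    · have hadj : G.Adj (Sum.inl (σ.symm x)) (Sum.inr v) := by simpa [bundle] using h
      have hle : ((bundle G σ v).filter fun z => gt.above z x).card ≤ k :=
        (Finset.card_filter_le _ _).trans (card_bundle hG σ v).le
      rw [dif_pos h, hP.position_eq v ⟨x, h⟩, Nat.add_sub_add_right, Nat.cast_sub hle]
      simp only [hadj, if_true, mul_one, one_mul]
      congr 1
      rw [← Finset.sum_filter, Finset.sum_const, nsmul_eq_mul, mul_one]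
      congr 2
      ext z
      simp [bundle, Ranking.mem_upper, and_comm]
    · have hadj : ¬ G.Adj (Sum.inl (σ.symm x)) (Sum.inr v) := by simpa [bundle] using h
      simp [h, hadj]
  have hk : (∑ v : V, if G.Adj (Sum.inl (σ.symm x)) (Sum.inr v) then (1 : ℝ) else 0) = k := by
    exact_mod_cast congrArg (Nat.cast (R := ℝ)) (hG.sum_adj_left (σ.symm x))
  rw [bordaScore, Nat.cast_sum, Finset.sum_congr rfl fun v _ => hterm v, Finset.sum_sub_distrib,
    ← Finset.mul_sum, hk, Finset.sum_comm]
  congr 1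
  refine Finset.sum_congr rfl fun z _ => ?_
  rw [commonBundles_eq_sum]
  push_cast
  rfl

end Score

/-! ### The variance of the number of points lost -/

section Variance

variable {U V A : Type*} [Fintype U] [DecidableEq U] [Fintype V] [Fintype A] [DecidableEq A]

/-- A uniformly random bijection is invariant under relabelling the elements. -/
theorem expect_equiv_comp_swap (f : (A → U) → ℝ) (a b : A) :
    𝔼 σ : U ≃ A, f (fun x => σ.symm (Equiv.swap a b x)) = 𝔼 σ : U ≃ A, f (fun x => σ.symm x) := by
  refine Fintype.expect_equiv
    ⟨fun σ => σ.trans (Equiv.swap a b), fun σ => σ.trans (Equiv.swap a b),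
      fun σ => by ext; simp, fun σ => by ext; simp⟩ _ _ fun σ => ?_
  simp

/-- The numbers of bundles that `x` shares with the other elements are exchangeable and add up to
`k * (k - 1)`. -/
theorem expect_sum_commonBundles_sub_sq_le {G : SimpleGraph (U ⊕ V)} [DecidableRel G.Adj]
    {n k : ℕ} (hG : IsBundleGraph G n k) (hA : Fintype.card A = n) {M : ℕ}
    (hM : ∀ u t, u ≠ t → commonBundles G u t ≤ M) (x : A) {t : Finset A} (hx : x ∉ t) :
    𝔼 σ : U ≃ A, (∑ z ∈ t, (commonBundles G (σ.symm x) (σ.symm z) : ℝ)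
      - t.card * ((k : ℝ) * (k - 1) / (n - 1))) ^ 2 ≤ (M : ℝ) * (k * (k - 1)) := by
  have : Nonempty (U ≃ A) := Fintype.card_eq.1 (hG.card_left.trans hA.symm)
  have hcard : ((Finset.univ.erase x).card : ℝ) = n - 1 := by
    rw [Finset.card_erase_of_mem (Finset.mem_univ x), Finset.card_univ, hA,
      Nat.cast_pred (hA ▸ Fintype.card_pos_iff.2 ⟨x⟩)]
  rw [← hcard]
  refine expect_partial_sum_sq_le (s := Finset.univ.erase x) (t := t)
    (X := fun z (σ : U ≃ A) => (commonBundles G (σ.symm x) (σ.symm z) : ℝ))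
    (fun z hz => Finset.mem_erase.2 ⟨ne_of_mem_of_not_mem hz hx, Finset.mem_univ z⟩) (fun σ => ?_) ?_ ?_
    (fun _ _ _ => Nat.cast_nonneg _) fun z hz σ => ?_
  · rw [← hG.sum_commonBundles (σ.symm x)]
    refine Finset.sum_equiv σ.symm (by simp) fun _ _ => rfl
  · intro i hi j hj
    have := expect_equiv_comp_swap
      (fun τ : A → U => (commonBundles G (τ x) (τ i) : ℝ)) i j
    simpa [Equiv.swap_apply_of_ne_of_ne (Finset.ne_of_mem_erase hi).symm
      (Finset.ne_of_mem_erase hj).symm] using this.symm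
  · intro i hi j hj l hl hij hil
    have := expect_equiv_comp_swap (fun τ : A → U =>
      (commonBundles G (τ x) (τ i) : ℝ) * (commonBundles G (τ x) (τ j) : ℝ)) j l
    simpa [Equiv.swap_apply_of_ne_of_ne (Finset.ne_of_mem_erase hj).symm
      (Finset.ne_of_mem_erase hl).symm, Equiv.swap_apply_of_ne_of_ne hij hil] using this.symm
  · exact_mod_cast hM _ _ fun h => Finset.ne_of_mem_erase hz (σ.symm.injective h).symm

end Variance

/-! ### The expected fraction of recovered relations -/

section Recovery

variable {U V A : Type*} [Fintype U] [DecidableEq U] [Fintype V] [Fintype A] [DecidableEq A]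

open Classical in
/-- Chebyshev's inequality for the difference of two Borda scores. -/
theorem expect_misordered_mul_sq_le {n k : ℕ} (hn : 2 ≤ n) (hA : Fintype.card A = n)
    {G : SimpleGraph (U ⊕ V)} [DecidableRel G.Adj] (hG : IsBundleGraph G n k) {gt : Ranking A}
    {P : ∀ σ : U ≃ A, Profile G σ} (hP : ∀ σ : U ≃ A, (P σ).IsConsistent gt)
    {out : (U ≃ A) → Ranking A} (hout : ∀ σ : U ≃ A, IsBordaOutcome k (P σ) (out σ)) {M : ℕ}
    (hM : ∀ u t, u ≠ t → commonBundles G u t ≤ M) {x y : A} (hxy : gt.above x y) :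
    (𝔼 σ : U ≃ A, if (out σ).above x y then (0 : ℝ) else 1) *
        ((gt.position y - gt.position x : ℕ) * (k * (k - 1) / (n - 1))) ^ 2
      ≤ 4 * ((M : ℝ) * (k * (k - 1))) := by
  set L : A → (U ≃ A) → ℝ := fun z σ =>
    ∑ w ∈ gt.upper z, (commonBundles G (σ.symm z) (σ.symm w) : ℝ) with hL
  set μ : ℝ := k * (k - 1) / (n - 1) with hμ
  have hself : ∀ z, z ∉ gt.upper z := fun z h => gt.irrefl z (gt.mem_upper.1 h)
  have hvar : ∀ z, 𝔼 σ, (L z σ - (gt.upper z).card * μ) ^ 2 ≤ (M : ℝ) * (k * (k - 1)) := fun z =>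
    expect_sum_commonBundles_sub_sq_le hG hA hM z (hself z)
  have hμ0 : 0 ≤ μ := by
    have h1 : (0 : ℝ) ≤ n - 1 := by
      have : (2 : ℝ) ≤ n := by exact_mod_cast hn
      linarith
    have h2 : (0 : ℝ) ≤ k * (k - 1) := by
      rcases Nat.eq_zero_or_pos k with rfl | hk
      · simp
      · have : (1 : ℝ) ≤ k := by exact_mod_cast hk
        nlinarith
    exact div_nonneg h2 h1
  have hpos : ((gt.position y - gt.position x : ℕ) : ℝ)
      = (gt.upper y).card - (gt.upper x).card := by
    rw [Nat.cast_sub (gt.position_lt hxy).le, gt.position_eq, gt.position_eq]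
    push_cast
    ring
  rw [hpos, Finset.expect_mul]
  calc _ ≤ 𝔼 σ, (2 * (L x σ - (gt.upper x).card * μ) ^ 2
            + 2 * (L y σ - (gt.upper y).card * μ) ^ 2) := by
        refine Finset.expect_le_expect fun σ _ => ?_
        split_ifs with h
        · rw [zero_mul]; positivity
        · have hscore : bordaScore k (P σ) x ≤ bordaScore k (P σ) y :=
            not_lt.1 fun hlt => h (hout σ x y hlt)
          have hscore' : (bordaScore k (P σ) x : ℝ) ≤ bordaScore k (P σ) y := by
            exact_mod_cast hscore
          rw [bordaScore_eq hG (hP σ), bordaScore_eq hG (hP σ)] at hscore'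
          have hLxy : L y σ ≤ L x σ := by simp only [hL]; linarith
          have hd : (0 : ℝ) ≤ (gt.upper y).card - (gt.upper x).card := by
            rw [← hpos]; positivity
          have hgap : ((gt.upper y).card - (gt.upper x).card : ℝ) * μ
              ≤ (L x σ - (gt.upper x).card * μ) - (L y σ - (gt.upper y).card * μ) := by linarith
          have hsq := pow_le_pow_left₀ (mul_nonneg hd hμ0) hgap 2
          nlinarith [sq_nonneg ((L x σ - (gt.upper x).card * μ)
            + (L y σ - (gt.upper y).card * μ))]
    _ ≤ 4 * ((M : ℝ) * (k * (k - 1))) := by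
        rw [Finset.expect_add_distrib, ← Finset.mul_expect, ← Finset.mul_expect]
        linarith [hvar x, hvar y]

open Classical in
theorem expect_recoveredFraction {gt : Ranking A} [Nonempty (U ≃ A)] (hA : 2 ≤ Fintype.card A)
    (out : (U ≃ A) → Ranking A) :
    𝔼 σ : U ≃ A, recoveredFraction gt (out σ)
      = 1 - (∑ x, ∑ y ∈ Finset.univ.filter (fun y => gt.above x y),
          𝔼 σ : U ≃ A, if (out σ).above x y then (0 : ℝ) else 1) /
            ((Fintype.card A).choose 2 : ℝ) := by
  have hC : (0 : ℝ) < (Fintype.card A).choose 2 := by exact_mod_cast Nat.choose_pos hA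
  have hσ : ∀ σ : U ≃ A, recoveredFraction gt (out σ)
      = 1 - (∑ x, ∑ y ∈ Finset.univ.filter (fun y => gt.above x y),
          if (out σ).above x y then (0 : ℝ) else 1) / ((Fintype.card A).choose 2 : ℝ) := by
    intro σ
    have hsplit := Finset.card_filter_add_card_filter_not
      (s := Finset.univ.filter fun p : A × A => gt.above p.1 p.2)
      (fun p => (out σ).above p.1 p.2)
    rw [gt.card_filter_above, Finset.filter_filter] at hsplit
    have hbad : (∑ x, ∑ y ∈ Finset.univ.filter (fun y => gt.above x y),
          if (out σ).above x y then (0 : ℝ) else 1)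
        = (((Finset.univ.filter fun p : A × A => gt.above p.1 p.2).filter
            fun p => ¬ (out σ).above p.1 p.2).card : ℝ) := by
      rw [Finset.card_filter, Finset.sum_filter, Fintype.sum_prod_type]
      push_cast
      refine Finset.sum_congr rfl fun x _ => ?_
      rw [Finset.sum_filter]
      refine Finset.sum_congr rfl fun y _ => ?_
      simp only [ite_not]
    rw [hbad, recoveredFraction, eq_sub_iff_add_eq, ← add_div, div_eq_one_iff_eq hC.ne']
    exact_mod_cast hsplit
  simp only [hσ]
  rw [Finset.expect_sub_distrib, Fintype.expect_const, ← Finset.expect_div,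
    Finset.expect_sum_comm]
  simp only [Finset.expect_sum_comm]

/-- A bound that depends on the graph only through the maximal number `M` of bundles that two
elements share. -/
theorem one_sub_le_expect_recoveredFraction {n k : ℕ} (hk : 2 ≤ k) (hn : 2 ≤ n)
    (hA : Fintype.card A = n)
    {G : SimpleGraph (U ⊕ V)} [DecidableRel G.Adj] (hG : IsBundleGraph G n k) {gt : Ranking A}
    {P : ∀ σ : U ≃ A, Profile G σ} (hP : ∀ σ : U ≃ A, (P σ).IsConsistent gt)
    {out : (U ≃ A) → Ranking A} (hout : ∀ σ : U ≃ A, IsBordaOutcome k (P σ) (out σ)) {M : ℕ}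
    (hM0 : 0 < M) (hM : ∀ u t, u ≠ t → commonBundles G u t ≤ M) :
    1 - 16 * √(M / (k * (k - 1))) ≤ 𝔼 σ : U ≃ A, recoveredFraction gt (out σ) := by
  classical
  have hne : Nonempty (U ≃ A) := Fintype.card_eq.1 (hG.card_left.trans hA.symm)
  have hn' : (0 : ℝ) < n - 1 := by
    have : (2 : ℝ) ≤ n := by exact_mod_cast hn
    linarith
  have hK : (0 : ℝ) < k * (k - 1) := by
    have : (2 : ℝ) ≤ k := by exact_mod_cast hk
    nlinarith
  have hMpos : (0 : ℝ) < M := by exact_mod_cast hM0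
  set c : ℝ := √(M / (k * (k - 1))) with hc
  have hc0 : 0 < c := Real.sqrt_pos.2 (by positivity)
  have hcsq : c ^ 2 = M / (k * (k - 1)) := Real.sq_sqrt (by positivity)
  set T : ℝ := 2 * c * (n - 1) with hT
  have hT0 : 0 < T := by positivity
  have hpair : ∀ x y, gt.above x y →
      (𝔼 σ : U ≃ A, if (out σ).above x y then (0 : ℝ) else 1)
        ≤ 4 * T ^ 2 / (T + (gt.position y - gt.position x : ℕ)) ^ 2 := by
    intro x y hxy
    refine le_four_mul_sq_div hT0 ?_ ?_ ?_ ?_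
    · exact_mod_cast Nat.sub_pos_of_lt (gt.position_lt hxy)
    · exact Finset.expect_nonneg fun σ _ => by split_ifs <;> norm_num
    · exact Finset.expect_le Finset.univ_nonempty fun σ _ => by split_ifs <;> norm_num
    · have h := expect_misordered_mul_sq_le hn hA hG hP hout hM hxy
      have hTsq : T ^ 2 = 4 * (M * (k * (k - 1))) / (k * (k - 1) / (n - 1)) ^ 2 := by
        rw [hT, mul_pow, mul_pow, hcsq]
        field_simp
        norm_num
      rw [hTsq, le_div_iff₀ (by positivity)]
      calc _ = _ := by ring
        _ ≤ _ := h
  have hsum : ∑ x, ∑ y ∈ Finset.univ.filter (fun y => gt.above x y),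
      (𝔼 σ : U ≃ A, if (out σ).above x y then (0 : ℝ) else 1) ≤ n * (4 * T) := by
    calc _ ≤ ∑ _x : A, 4 * T := by
          refine Finset.sum_le_sum fun x _ => ?_
          refine (Finset.sum_le_sum fun y hy => hpair x y (Finset.mem_filter.1 hy).2).trans ?_
          exact (gt.sum_above_le x (fun d => 4 * T ^ 2 / (T + d) ^ 2)
            fun d => by positivity).trans (sum_four_mul_sq_div_le hT0 _)
      _ = n * (4 * T) := by rw [Finset.sum_const, Finset.card_univ, hA, nsmul_eq_mul]
  rw [expect_recoveredFraction (hA.symm ▸ hn), hA, Nat.cast_choose_two]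
  have hn0 : (0 : ℝ) < n := by linarith
  have : (∑ x, ∑ y ∈ Finset.univ.filter (fun y => gt.above x y),
      (𝔼 σ : U ≃ A, if (out σ).above x y then (0 : ℝ) else 1)) / ((n : ℝ) * (n - 1) / 2)
        ≤ 16 * c := by
    rw [div_le_iff₀ (by positivity)]
    calc _ ≤ _ := hsum
      _ = _ := by rw [hT]; ring
  linarith

end Recovery

theorem theorem1 {U V A : Type*} [Fintype U] [DecidableEq U] [Fintype V]
    [Fintype A] [DecidableEq A] (n k : ℕ) (hk : 3 ≤ k) (hn : 3 * k * (k - 1) + 2 ≤ n)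
    (hA : Fintype.card A = n)
    (G : SimpleGraph (U ⊕ V)) [DecidableRel G.Adj] (hG : IsBundleGraph G n k)
    (gt : Ranking A)
    (P : ∀ σ : U ≃ A, Profile G σ) (hP : ∀ σ : U ≃ A, (P σ).IsConsistent gt)
    (out : (U ≃ A) → Ranking A) (hout : ∀ σ : U ≃ A, IsBordaOutcome k (P σ) (out σ)) :
    1 - 48 * √(2 * Real.pi) / √(k : ℝ) ≤ 𝔼 σ : U ≃ A, recoveredFraction gt (out σ) ∧
    (6 ≤ G.egirth →
      1 - 16 * √(3 * Real.pi) / (k : ℝ) ≤ 𝔼 σ : U ≃ A, recoveredFraction gt (out σ)) := by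
  have hn2 : 2 ≤ n := le_trans (Nat.le_add_left _ _) hn
  have hk' : (3 : ℝ) ≤ k := by exact_mod_cast hk
  have hpi := Real.pi_gt_three
  constructor
  · refine le_trans ?_ (one_sub_le_expect_recoveredFraction (by omega) hn2 hA hG hP hout
      (by omega) fun u t _ => hG.commonBundles_le u t)
    -- `1 / (k - 1) ≤ 2 / k`, and the factor `16` leaves much room below `48`
    have hle : √((k : ℝ) / (k * (k - 1))) ≤ √(2 * Real.pi) / √(k : ℝ) := by
      rw [← Real.sqrt_div' _ (by positivity)]
      refine Real.sqrt_le_sqrt ?_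
      rw [div_le_div_iff₀ (by nlinarith) (by linarith)]
      nlinarith [mul_nonneg (by linarith : (0 : ℝ) ≤ k) (by linarith : (0 : ℝ) ≤ k - 3)]
    have h0 : 0 ≤ √(2 * Real.pi) / √(k : ℝ) := by positivity
    rw [mul_div_assoc]
    linarith
  · intro hgirth
    refine le_trans ?_ (one_sub_le_expect_recoveredFraction (M := 1) (by omega) hn2 hA hG hP hout
      one_pos fun u t hut => commonBundles_le_one hgirth hut)
    have hle : √(((1 : ℕ) : ℝ) / (k * (k - 1))) ≤ √(3 * Real.pi) / (k : ℝ) := by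
      rw [Real.sqrt_le_left (by positivity), div_pow, Real.sq_sqrt (by positivity), Nat.cast_one,
        div_le_div_iff₀ (by nlinarith) (by positivity)]
      nlinarith [mul_nonneg (by linarith : (0 : ℝ) ≤ k) (by linarith : (0 : ℝ) ≤ k - 3)]
    rw [mul_div_assoc]
    linarith
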